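/- Let $W$ be a real Banach space and let $V = W^*$ be its topological dual; write $(V,\|\cdot\|)$ for $V$ with the dual norm topology and $(V,w^*)$ for $V$ with the weak$^*$ topology. Let $X$ be a connected, locally connected, first countable, normal topological space (normal spaces being Hausdorff), and let $f\colon X\to V$ be a map such that $f\colon X\to (V,\|\cdot\|)$ is continuous and $f\colon X\to (V,w^*)$ is closed. Assume: (a) $f$ has local convexity data with respect to the norm topology: for each $x\in X$ and every sufficiently small open neighborhood $U$ of $x$ there is a convex cone $C\subset V$ with vertex $f(x)$ (that is, $C$ is convex, $f(x)\in C$, and $(1-\lambda)f(x)+\lambda v\in C$ for all $v\in C$ and $\lambda\ge 0$) such that, with $C$ carrying the subspace topology of $(V,\|\cdot\|)$: $f(U)\subset C$ and $f(U)$ is a neighborhood of $f(x)$ in $C$; $f|_U\colon U\to C$ is an open map; and for every neighborhood $U'\subset U$ of $x$ the set $f(U')$ is a neighborhood of $f(x)$ in $C$. (b) $f$ is locally fiber connected: for each $x\in X$, every open neighborhood of $x$ contains a neighborhood $U$ of $x$ such that, for every $y\in U$, $U$ does not meet two different connected components of the fiber $f^{-1}(f(y))$. Then: (i) all the (nonempty)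 fibers $f^{-1}(v)$, $v\in f(X)$, are connected; (ii) $f\colon X\to (V,w^*)$ is open onto its image, i.e. $f\colon X\to f(X)$ is an open map when $f(X)$ carries the subspace topology of $(V,w^*)$; (iii) the image $f(X)$ is a closed subset of $(V,w^*)$ and is convex. -/

import Mathlib

open Set Topology

section LocalGlobal

variable {X V : Type*} [TopologicalSpace X] [AddCommGroup V] [Module ℝ V] [TopologicalSpace V]

/-- `C` is a cone with vertex `v₀`: it contains `v₀` and, with each point, the whole closed
half-line issuing from `v₀` through that point. -/
def IsConeWithVertex {V : Type*} [AddCommGroup V] [Module ℝ V] (C : Set V) (v₀ : V) : Prop :=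
  v₀ ∈ C ∧ ∀ v ∈ C, v ≠ v₀ → ∀ t : ℝ, 0 ≤ t → (1 - t) • v₀ + t • v ∈ C

/-- `f` has local convexity data: for each `x` and every sufficiently small open neighborhood
`U` of `x` there is a convex cone `C` with vertex `f x` such that `f U ⊆ C` is a neighborhood of
the vertex in `C`, the map `f|_U : U → C` is open, and `f U'` is a neighborhood of the vertex
in `C` for every neighborhood `U' ⊆ U` of `x`. The cone has the subspace topology from `V`. -/
def HasLocalConvexityData (f : X → V) : Prop :=
  ∀ x : X, ∃ N ∈ 𝓝 x, ∀ U : Set X, IsOpen U → x ∈ U → U ⊆ N →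
    ∃ (C : Set V) (hUC : MapsTo f U C),
      Convex ℝ C ∧ IsConeWithVertex C (f x) ∧
      f '' U ∈ 𝓝[C] (f x) ∧
      IsOpenMap (MapsTo.restrict f U C hUC) ∧
      ∀ U' : Set X, U' ∈ 𝓝 x → U' ⊆ U → f '' U' ∈ 𝓝[C] (f x)

/-- Condition (LFC) for a subset `A`: it does not meet two different connected components of
the fiber `f ⁻¹(f x)`, for any `x ∈ A`. -/
def SatisfiesLFC {X Y : Type*} [TopologicalSpace X] (f : X → Y) (A : Set X) : Prop :=
  ∀ x ∈ A, ∀ p ∈ A ∩ f ⁻¹' {f x}, ∀ q ∈ A ∩ f ⁻¹' {f x},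
    connectedComponentIn (f ⁻¹' {f x}) p = connectedComponentIn (f ⁻¹' {f x}) q

/-- `f` is locally fiber connected: every open neighborhood of every point `x` contains a
neighborhood of `x` that satisfies (LFC). -/
def IsLocallyFiberConnected {X Y : Type*} [TopologicalSpace X] (f : X → Y) : Prop :=
  ∀ x : X, ∀ O : Set X, IsOpen O → x ∈ O → ∃ U ∈ 𝓝 x, U ⊆ O ∧ SatisfiesLFC f U

end LocalGlobal

/-! Collapse each connected component of each fiber to a point. The induced map φ on the quotient M
= `FiberComponents f` should be injective with convex range: injectivity says that fibers are
connected.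

Two properties of φ suffice. Each point of M has a convex sheet (`exists_isConvexSheet`): local
convexity data and fiber connectedness give a chart, and normality with closedness of `f` separates
its sheet from the rest of the fiber. And φ is proper (`isProperMap_fiberComponentsMap`): it is
closed, and its fibers are finite by a Tietze argument.

For such φ, straight segments lift. Visibility from a point is a closed condition by properness, and
transitive because the end point of a lifted segment can be swept along another one
(`Visible.trans`). On the connected space M every point therefore sees every other. Lifted segments
give convexity; a lift of a constant segment stays in one sheet, which gives injectivity.

All this runs in the norm topology, where `f` is also closed. Weak* openness follows because
saturations of open sets are open and `f` is weak* closed. -/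

open Filter

/-! ### Convex sheets and lifts of segments along a proper map. -/

section SegmentLifting

variable {M V : Type*} [TopologicalSpace M] [NormedAddCommGroup V] [NormedSpace ℝ V]

/-- An open set `D` is a convex sheet of `φ` over the open set `B` if it is relatively clopen in
`φ ⁻¹' B` and `φ` maps it bijectively onto a convex subset of `B`. -/
structure IsConvexSheet (φ : M → V) (B : Set V) (D : Set M) : Prop where
  isOpen_base : IsOpen B
  mapsTo : MapsTo φ D B
  isOpen : IsOpen D
  isOpen_diff : IsOpen (φ ⁻¹' B \ D)
  injOn : InjOn φ D
  convex : Convex ℝ (φ '' D)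

/-- The point `y` is visible from `x` if the segment from `φ x` to `φ y` lifts along `φ` to a path
from `x` to `y`. -/
def Visible (φ : M → V) (x y : M) : Prop :=
  ∃ γ : ℝ → M, ContinuousOn γ (Icc 0 1) ∧ γ 0 = x ∧ γ 1 = y ∧
    ∀ t ∈ Icc (0 : ℝ) 1, φ (γ t) = AffineMap.lineMap (φ x) (φ y) t

/-- The vector `w` is a feasible direction at `p` if `φ p + δ • w` lies in the image of a sheet
through `p` for some `δ > 0`. -/
def IsFeasible (φ : M → V) (w : V) (p : M) : Prop :=
  ∃ B D, IsConvexSheet φ B D ∧ p ∈ D ∧ ∃ δ : ℝ, 0 < δ ∧ φ p + δ • w ∈ φ '' D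

variable {φ : M → V} {B : Set V} {D : Set M}

theorem IsConvexSheet.subset_of_isPreconnected (hD : IsConvexSheet φ B D) {S : Set M}
    (hS : IsPreconnected S) (hSB : MapsTo φ S B) (hSD : (S ∩ D).Nonempty) : S ⊆ D := by
  refine IsPreconnected.subset_left_of_subset_union hD.isOpen hD.isOpen_diff disjoint_sdiff_right
    (fun x hx => ?_) hSD hS
  by_cases h : x ∈ D
  · exact Or.inl h
  · exact Or.inr ⟨hSB hx, h⟩

theorem IsConvexSheet.mem_of_tendsto (hD : IsConvexSheet φ B D) {ι : Type*} {l : Filter ι}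
    [l.NeBot] {g : ι → M} {p : M} (hg : ∀ᶠ i in l, g i ∈ D) (hp : φ p ∈ B)
    (h : Tendsto g l (𝓝 p)) : p ∈ D := by
  by_contra hpD
  obtain ⟨i, hi, hi'⟩ := (hg.and (h (hD.isOpen_diff.mem_nhds ⟨hp, hpD⟩))).exists
  exact hi'.2 hi

/-- Properness gives every ultrafilter a limit over `φ p`; relative closedness puts it in `D`, and
injectivity on `D` makes it `p`. So the inverse of φ on a sheet is continuous. -/
theorem IsConvexSheet.tendsto_of_tendsto_comp (hD : IsConvexSheet φ B D) (hφ : IsProperMap φ)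
    {ι : Type*} {l : Filter ι} {g : ι → M} {p : M} (hp : p ∈ D) (hg : ∀ᶠ i in l, g i ∈ D)
    (h : Tendsto (fun i => φ (g i)) l (𝓝 (φ p))) : Tendsto g l (𝓝 p) := by
  rw [tendsto_iff_ultrafilter]
  intro u hu
  have h1 : Tendsto φ (u.map g : Ultrafilter M) (𝓝 (φ p)) := h.comp hu
  obtain ⟨q, hq, hq'⟩ := (isProperMap_iff_ultrafilter.1 hφ).2 h1
  have hqD : q ∈ D := by
    refine hD.mem_of_tendsto (l := (u : Filter ι)) (hg.filter_mono hu) ?_ hq'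
    rw [hq]
    exact hD.mapsTo hp
  rw [hD.injOn hp hqD hq.symm]
  exact hq'

theorem IsConvexSheet.exists_lift (hD : IsConvexSheet φ B D) (hφ : IsProperMap φ) {T : Type*}
    [TopologicalSpace T] {s : Set T} {c : T → V} (hc : ContinuousOn c s) [Nonempty M]
    (hcD : MapsTo c s (φ '' D)) :
    ∃ g : T → M, ContinuousOn g s ∧ ∀ t ∈ s, g t ∈ D ∧ φ (g t) = c t := by
  choose! g hg using fun t (ht : t ∈ s) => hcD ht
  refine ⟨g, fun t ht => ?_, hg⟩
  refine hD.tendsto_of_tendsto_comp hφ (hg t ht).1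
    (eventually_nhdsWithin_of_forall fun τ hτ => (hg τ hτ).1) ?_
  rw [(hg t ht).2]
  exact (hc t ht).congr' (eventually_nhdsWithin_of_forall fun τ hτ => (hg τ hτ).2.symm)

theorem continuousOn_of_locally_mem_sheet (hφ : IsProperMap φ) {T : Type*} [TopologicalSpace T]
    {s : Set T} {g : T → M} (hc : ContinuousOn (fun t => φ (g t)) s)
    (h : ∀ t ∈ s, ∃ B D, IsConvexSheet φ B D ∧ ∀ᶠ τ in 𝓝[s] t, g τ ∈ D) : ContinuousOn g s := by
  intro t ht
  obtain ⟨B, D, hD, hg⟩ := h t ht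
  exact hD.tendsto_of_tendsto_comp hφ (hg.self_of_nhdsWithin ht) hg (hc t ht)

theorem IsConvexSheet.exists_segment_lift (hD : IsConvexSheet φ B D) (hφ : IsProperMap φ)
    {x y : M} (hx : x ∈ D) (hy : y ∈ D) :
    ∃ γ : ℝ → M, ContinuousOn γ (Icc 0 1) ∧ γ 0 = x ∧ γ 1 = y ∧
      ∀ t ∈ Icc (0 : ℝ) 1, γ t ∈ D ∧ φ (γ t) = AffineMap.lineMap (φ x) (φ y) t := by
  have : Nonempty M := ⟨x⟩
  obtain ⟨g, hg, hg'⟩ := hD.exists_lift hφ (s := Icc (0 : ℝ) 1)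
    (c := fun t => AffineMap.lineMap (φ x) (φ y) t) (by fun_prop)
    (fun t ht => hD.convex.lineMap_mem (mem_image_of_mem φ hx) (mem_image_of_mem φ hy) ht)
  refine ⟨g, hg, ?_, ?_, hg'⟩
  · have := hg' 0 (by simp)
    exact hD.injOn this.1 hx (by simpa using this.2)
  · have := hg' 1 (by simp)
    exact hD.injOn this.1 hy (by simpa using this.2)

theorem IsConvexSheet.visible (hD : IsConvexSheet φ B D) (hφ : IsProperMap φ)
    {x y : M} (hx : x ∈ D) (hy : y ∈ D) : Visible φ x y := by
  obtain ⟨γ, h, h0, h1, h2⟩ := hD.exists_segment_lift hφ hx hy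
  exact ⟨γ, h, h0, h1, fun t ht => (h2 t ht).2⟩

/-- If a point `y` of a sheet `D` shares another sheet with `z` and the image of `D` contains the
end point `φ z`, then `z` lies in `D`. -/
theorem IsConvexSheet.mem_of_mem_sheet (hD : IsConvexSheet φ B D) (hφ : IsProperMap φ)
    {B' : Set V} {D' : Set M} (hD' : IsConvexSheet φ B' D') {y z : M} (hy : y ∈ D)
    (hy' : y ∈ D') (hz' : z ∈ D') (hz : φ z ∈ φ '' D) : z ∈ D := by
  obtain ⟨γ, h, h0, h1, h2⟩ := hD'.exists_segment_lift hφ hy' hz'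
  have hsub : γ '' Icc 0 1 ⊆ D := by
    refine hD.subset_of_isPreconnected (isPreconnected_Icc.image γ h) ?_
      ⟨y, ⟨0, by simp, h0⟩, hy⟩
    rintro _ ⟨t, ht, rfl⟩
    rw [(h2 t ht).2]
    exact hD.mapsTo.image_subset (hD.convex.lineMap_mem (mem_image_of_mem φ hy) hz ht)
  exact hsub ⟨1, by simp, h1⟩

theorem IsConvexSheet.add_smul_mem_image (hD : IsConvexSheet φ B D) {p : M} (hp : p ∈ D) {w : V}
    {δ ε : ℝ} (hε : 0 ≤ ε) (hδ : ε ≤ δ) (h : φ p + δ • w ∈ φ '' D) : φ p + ε • w ∈ φ '' D := by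
  rcases hε.eq_or_lt with rfl | hε
  · simpa using mem_image_of_mem φ hp
  have := hD.convex.add_smul_sub_mem (mem_image_of_mem φ hp) h
    (t := ε / δ) ⟨div_nonneg hε.le (hε.le.trans hδ), (div_le_one (hε.trans_le hδ)).2 hδ⟩
  have hδ0 : δ ≠ 0 := (hε.trans_le hδ).ne'
  simpa [smul_smul, div_mul_cancel₀ _ hδ0] using this

/-- Feasibility does not depend on the sheet: a short segment lifted in one sheet through `p` stays
over `B`, hence in `D` by connectedness. -/
theorem IsFeasible.eventually (hφ : IsProperMap φ) {w : V} {p : M} (h : IsFeasible φ w p)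
    (hD : IsConvexSheet φ B D) (hp : p ∈ D) :
    ∀ᶠ δ in 𝓝[>] (0 : ℝ), φ p + δ • w ∈ φ '' D := by
  obtain ⟨B', D', hD', hp', δ, hδ, hmem⟩ := h
  have : Nonempty M := ⟨p⟩
  have hB : ∀ᶠ ε in 𝓝 (0 : ℝ), φ p + ε • w ∈ B := by
    have : Tendsto (fun ε : ℝ => φ p + ε • w) (𝓝 0) (𝓝 (φ p + (0 : ℝ) • w)) :=
      Continuous.tendsto (by fun_prop) 0
    exact this (hD.isOpen_base.mem_nhds (by simpa using hD.mapsTo hp))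
  obtain ⟨r, hr, hrB⟩ := Metric.eventually_nhds_iff.1 hB
  filter_upwards [Ioo_mem_nhdsGT (lt_min hδ hr)] with ε hε
  obtain ⟨g, hg, hg'⟩ := hD'.exists_lift hφ (s := Icc 0 ε) (c := fun ε : ℝ => φ p + ε • w)
    (by fun_prop) (fun τ hτ => hD'.add_smul_mem_image hp' hτ.1
      (hτ.2.trans (hε.2.le.trans (min_le_left _ _))) hmem)
  have hsub : g '' Icc 0 ε ⊆ D := by
    refine hD.subset_of_isPreconnected (isPreconnected_Icc.image g hg) ?_
      ⟨p, ⟨0, ⟨le_rfl, hε.1.le⟩, ?_⟩, hp⟩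
    · rintro _ ⟨τ, hτ, rfl⟩
      rw [(hg' τ hτ).2]
      refine hrB ?_
      rw [Real.dist_eq, sub_zero, abs_of_nonneg hτ.1]
      exact hτ.2.trans_lt (hε.2.trans_le (min_le_right _ _))
    · have := hg' 0 ⟨le_rfl, hε.1.le⟩
      exact hD'.injOn this.1 hp' (by simpa using this.2)
  exact ⟨g ε, hsub ⟨ε, ⟨hε.1.le, le_rfl⟩, rfl⟩, (hg' ε ⟨hε.1.le, le_rfl⟩).2⟩

/-- Lifts to points converging to `y` have pointwise ultrafilter limits by properness. The limit
path is continuous because near each time it stays in a single sheet. -/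
theorem isClosed_setOf_visible (hφ : IsProperMap φ)
    (hsheet : ∀ p : M, ∃ B D, IsConvexSheet φ B D ∧ p ∈ D) (x : M) :
    IsClosed {y | Visible φ x y} := by
  rw [isClosed_iff_ultrafilter]
  intro y u hu hmem
  have : Nonempty M := ⟨y⟩
  have hvis : ∀ᶠ z in (u : Filter M), Visible φ x z := hmem
  choose! γ hγc hγ0 hγ1 hγ using fun z (hz : Visible φ x z) => hz
  have hlim : ∀ t ∈ Icc (0 : ℝ) 1, ∃ m, Tendsto (fun z => γ z t) u (𝓝 m) ∧
      φ m = AffineMap.lineMap (φ x) (φ y) t ∧ (t = 0 → m = x) ∧ (t = 1 → m = y) := by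
    intro t ht
    -- Limits in `M` are not known to be unique, so the end points are prescribed.
    rcases eq_or_ne t 0 with rfl | h0
    · refine ⟨x, ?_, by simp, by simp, by simp⟩
      exact tendsto_const_nhds.congr' (hvis.mono fun z hz => (hγ0 z hz).symm)
    rcases eq_or_ne t 1 with rfl | h1
    · refine ⟨y, ?_, by simp, by simp, by simp⟩
      have : Tendsto id (u : Filter M) (𝓝 y) := hu
      exact this.congr' (hvis.mono fun z hz => (hγ1 z hz).symm)
    have h : Tendsto φ (u.map (fun z => γ z t) : Ultrafilter M)
        (𝓝 (AffineMap.lineMap (φ x) (φ y) t)) := by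
      have h1 : Tendsto (fun z => AffineMap.lineMap (φ x) (φ z) t) (u : Filter M)
          (𝓝 (AffineMap.lineMap (φ x) (φ y) t)) := by
        have : Continuous fun z => AffineMap.lineMap (φ x) (φ z) t := by
          have := hφ.continuous
          simp only [AffineMap.lineMap_apply_module]
          fun_prop
        exact (this.tendsto y).mono_left hu
      have h2 : Tendsto (fun z => φ (γ z t)) (u : Filter M)
          (𝓝 (AffineMap.lineMap (φ x) (φ y) t)) :=
        h1.congr' (hvis.mono fun z hz => (hγ z hz t ht).symm)
      exact h2
    obtain ⟨m, hm, hm'⟩ := (isProperMap_iff_ultrafilter.1 hφ).2 h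
    exact ⟨m, hm', hm, fun h => absurd h h0, fun h => absurd h h1⟩
  choose! g hg hgφ hg0 hg1 using hlim
  refine ⟨g, ?_, hg0 0 (by simp) rfl, hg1 1 (by simp) rfl, hgφ⟩
  refine continuousOn_of_locally_mem_sheet hφ ?_ ?_
  · refine ContinuousOn.congr (f := fun t => AffineMap.lineMap (φ x) (φ y) t) (by fun_prop) hgφ
  intro t ht
  obtain ⟨B, D, hD, hp⟩ := hsheet (g t)
  refine ⟨B, D, hD, ?_⟩
  -- Joint continuity gives one time interval on which the segments stay in `B` for all end points
  -- near `y`.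
  have hcont : Continuous fun q : ℝ × M => AffineMap.lineMap (φ x) (φ q.2) q.1 := by
    have := hφ.continuous
    simp only [AffineMap.lineMap_apply_module]
    fun_prop
  have hB : ∀ᶠ q in 𝓝 t ×ˢ 𝓝 y, AffineMap.lineMap (φ x) (φ q.2) q.1 ∈ B := by
    rw [← nhds_prod_eq]
    refine hcont.continuousAt (hD.isOpen_base.mem_nhds ?_)
    have := hD.mapsTo hp
    rwa [hgφ t ht] at this
  obtain ⟨P, hP, Q, hQ, hPQ⟩ := eventually_prod_iff.1 hB
  obtain ⟨ε, hε, hεP⟩ := Metric.eventually_nhds_iff_ball.1 hP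
  filter_upwards [self_mem_nhdsWithin, mem_nhdsWithin_of_mem_nhds (Metric.ball_mem_nhds t hε)]
    with τ hτ hτε
  have hsub : uIcc t τ ⊆ Icc 0 1 := ordConnected_Icc.uIcc_subset ht hτ
  have hball : uIcc t τ ⊆ Metric.ball t ε := by
    rw [← segment_eq_uIcc]
    exact (convex_ball t ε).segment_subset (Metric.mem_ball_self hε) hτε
  have hev : ∀ᶠ z in (u : Filter M), γ z τ ∈ D := by
    filter_upwards [hvis, hQ.filter_mono hu, hg t ht (hD.isOpen.mem_nhds hp)] with z hz hzQ hzD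
    have : γ z '' uIcc t τ ⊆ D := by
      refine hD.subset_of_isPreconnected
        (isPreconnected_uIcc.image _ ((hγc z hz).mono hsub)) ?_ ⟨_, ⟨t, left_mem_uIcc, rfl⟩, hzD⟩
      rintro _ ⟨σ, hσ, rfl⟩
      rw [hγ z hz σ (hsub hσ)]
      exact hPQ (hεP σ (hball hσ)) hzQ
    exact this ⟨τ, right_mem_uIcc, rfl⟩
  refine hD.mem_of_tendsto hev ?_ (hg τ hτ)
  rw [hgφ τ hτ]
  exact hPQ (hεP τ hτε) (mem_of_mem_nhds hQ)

/-! ### Moving the end point of a lifted segment. -/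

theorem exists_ball_mapsTo_sheet (hsheet : ∀ p : M, ∃ B D, IsConvexSheet φ B D ∧ p ∈ D)
    {γ : ℝ → M} (hγ : ContinuousOn γ (Icc 0 1)) {t : ℝ} (ht : t ∈ Icc (0 : ℝ) 1) :
    ∃ B D, IsConvexSheet φ B D ∧ ∃ ε > 0, ∀ τ ∈ Icc (0 : ℝ) 1, |τ - t| < ε → γ τ ∈ D := by
  obtain ⟨B, D, hD, hp⟩ := hsheet (γ t)
  refine ⟨B, D, hD, ?_⟩
  have h := hγ t ht (hD.isOpen.mem_nhds hp)
  obtain ⟨ε, hε, h⟩ := Metric.mem_nhdsWithin_iff.1 h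
  exact ⟨ε, hε, fun τ hτ hτε => h ⟨by rwa [Metric.mem_ball, Real.dist_eq], hτ⟩⟩

theorem IsFeasible.of_lineMap (hφ : IsProperMap φ) {w : V} (hD : IsConvexSheet φ B D) {p q r : M}
    (hp : p ∈ D) (hq : q ∈ D) (hr : r ∈ D) {c : ℝ} (hc : c ∈ Ioc (0 : ℝ) 1)
    (hqr : φ q = AffineMap.lineMap (φ p) (φ r) c) (h : IsFeasible φ w r) : IsFeasible φ w q := by
  obtain ⟨δ, hδ, hδ0⟩ := ((h.eventually hφ hD hr).and self_mem_nhdsWithin).exists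
  refine ⟨B, D, hD, hq, c * δ, mul_pos hc.1 hδ0, ?_⟩
  convert hD.convex.lineMap_mem (mem_image_of_mem φ hp) hδ ⟨hc.1.le, hc.2⟩ using 1
  rw [hqr]
  simp only [AffineMap.lineMap_apply_module]
  module

/-- Feasibility of a direction at the end point of a lifted segment propagates along the segment. -/
theorem isFeasible_of_segment (hφ : IsProperMap φ)
    (hsheet : ∀ p : M, ∃ B D, IsConvexSheet φ B D ∧ p ∈ D) {γ : ℝ → M} {a d w : V}
    (hγ : ContinuousOn γ (Icc 0 1))
    (hγφ : ∀ t ∈ Icc (0 : ℝ) 1, φ (γ t) = AffineMap.lineMap a d t)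
    (h1 : IsFeasible φ w (γ 1)) {t : ℝ} (ht : t ∈ Ioc (0 : ℝ) 1) : IsFeasible φ w (γ t) := by
  have key : ∀ B D, IsConvexSheet φ B D → ∀ t₀ ∈ Icc (0 : ℝ) 1, ∀ t₁ ∈ Icc (0 : ℝ) 1,
      γ t₀ ∈ D → γ t₁ ∈ D → ∀ c ∈ Ioc (0 : ℝ) 1, γ (AffineMap.lineMap t₀ t₁ c) ∈ D →
      IsFeasible φ w (γ t₁) → IsFeasible φ w (γ (AffineMap.lineMap t₀ t₁ c)) := by
    intro B D hD t₀ ht₀ t₁ ht₁ h₀ h₁ c hc h₂ hf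
    refine hf.of_lineMap hφ hD h₀ h₂ h₁ hc ?_
    rw [hγφ _ ht₀, hγφ _ ht₁, hγφ _ ((convex_Icc 0 1).lineMap_mem ht₀ ht₁ ⟨hc.1.le, hc.2⟩)]
    simp only [AffineMap.lineMap_apply_module, smul_eq_mul]
    module
  have loc : ∀ t ∈ Icc (0 : ℝ) 1, ∃ ε > 0, ∀ t₁ ∈ Icc (0 : ℝ) 1, ∀ t₂ ∈ Ioo (0 : ℝ) 1,
      |t₁ - t| < ε → |t₂ - t| < ε → IsFeasible φ w (γ t₁) → IsFeasible φ w (γ t₂) := by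
    intro t ht
    obtain ⟨B, D, hD, ε, hε, hmem⟩ := exists_ball_mapsTo_sheet hsheet hγ ht
    refine ⟨ε, hε, fun t₁ ht₁ t₂ ht₂ h₁ h₂ hf => ?_⟩
    -- Overshooting `t₂` slightly, away from `t₁`, puts it between two points of the sheet, so `key`
    -- applies. This needs `t₂` interior; feasibility may fail at time 0.
    have hev : ∀ᶠ η in 𝓝[>] (0 : ℝ), t₂ + η * (t₂ - t₁) ∈ Ioo (0 : ℝ) 1 ∩ Metric.ball t ε := by
      have : Tendsto (fun η : ℝ => t₂ + η * (t₂ - t₁)) (𝓝[>] 0) (𝓝 (t₂ + 0 * (t₂ - t₁))) :=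
        (Continuous.tendsto (by fun_prop) 0).mono_left nhdsWithin_le_nhds
      refine this ((isOpen_Ioo.inter Metric.isOpen_ball).mem_nhds ?_)
      simpa [Real.dist_eq] using ⟨ht₂, h₂⟩
    obtain ⟨η, ⟨hη, hηε⟩, hη0⟩ := (hev.and self_mem_nhdsWithin).exists
    have hη0 : 0 < η := hη0
    have heq : AffineMap.lineMap (t₂ + η * (t₂ - t₁)) t₁ (η / (1 + η)) = t₂ := by
      simp only [AffineMap.lineMap_apply_module, smul_eq_mul]
      field_simp
      ring
    have := key B D hD _ (Ioo_subset_Icc_self hη) t₁ ht₁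
      (hmem _ (Ioo_subset_Icc_self hη) (by simpa [Real.dist_eq] using hηε)) (hmem _ ht₁ h₁)
      (η / (1 + η)) ⟨by positivity, (div_le_one (by positivity)).2 (by linarith)⟩
    rw [heq] at this
    exact this (hmem _ (Ioo_subset_Icc_self ht₂) h₂) hf
  rcases ht.2.eq_or_lt with rfl | ht1
  · exact h1
  obtain ⟨ε, hε, hloc⟩ := loc 1 (by simp)
  obtain ⟨s, hs⟩ : (Ioo (max 0 (1 - ε)) 1).Nonempty := by
    rw [nonempty_Ioo]
    exact max_lt one_pos (by linarith)
  have hs0 : s ∈ Ioo (0 : ℝ) 1 := ⟨(le_max_left _ _).trans_lt hs.1, hs.2⟩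
  have hfs : IsFeasible φ w (γ s) := by
    refine hloc 1 (by simp) s hs0 (by simpa using hε) ?_ h1
    rw [abs_lt]
    have := (le_max_right _ _).trans_lt hs.1
    constructor <;> linarith [hs.2]
  have hiff : IsFeasible φ w (γ s) ↔ IsFeasible φ w (γ t) := by
    refine isPreconnected_Ioo.induction₂ (fun s t => IsFeasible φ w (γ s) ↔ IsFeasible φ w (γ t))
      ?_ ?_ ?_ hs0 ⟨ht.1, ht1⟩
    · intro t ht
      obtain ⟨ε, hε, hloc⟩ := loc t (Ioo_subset_Icc_self ht)
      filter_upwards [self_mem_nhdsWithin,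
        mem_nhdsWithin_of_mem_nhds (Metric.ball_mem_nhds t hε)] with τ hτ hτε
      rw [Metric.mem_ball, Real.dist_eq] at hτε
      have h0 : |t - t| < ε := by simpa using hε
      exact ⟨hloc t (Ioo_subset_Icc_self ht) τ hτ h0 hτε,
        hloc τ (Ioo_subset_Icc_self hτ) t ht hτε h0⟩
    · intro x y z _ _ _ h h'
      exact h.trans h'
    · intro x y _ _ h
      exact h.symm
  exact hiff.1 hfs

/-- Lifts of the segments from `a` to `d + δ • w` exist locally for small `δ`, uniformly in `δ`. -/
theorem exists_sheet_eventually_mem_image (hφ : IsProperMap φ)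
    (hsheet : ∀ p : M, ∃ B D, IsConvexSheet φ B D ∧ p ∈ D) {γ : ℝ → M} {a d w : V}
    (hγ : ContinuousOn γ (Icc 0 1))
    (hγφ : ∀ t ∈ Icc (0 : ℝ) 1, φ (γ t) = AffineMap.lineMap a d t)
    (h1 : IsFeasible φ w (γ 1)) {t : ℝ} (ht : t ∈ Icc (0 : ℝ) 1) :
    ∃ B D, IsConvexSheet φ B D ∧ ∃ U : Set ℝ, IsOpen U ∧ t ∈ U ∧
      ∀ᶠ δ in 𝓝[>] (0 : ℝ), ∀ τ ∈ Icc (0 : ℝ) 1 ∩ U, γ τ ∈ D ∧ φ (γ τ) + (τ * δ) • w ∈ φ '' D := by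
  obtain ⟨B, D, hD, ε, hε, hmem⟩ := exists_ball_mapsTo_sheet hsheet hγ ht
  refine ⟨B, D, hD, Metric.ball t (ε / 2), Metric.isOpen_ball,
    Metric.mem_ball_self (half_pos hε), ?_⟩
  have hfe : ∀ s ∈ Icc (0 : ℝ) 1, |s - t| < ε →
      ∀ᶠ δ in 𝓝[>] (0 : ℝ), φ (γ s) + (s * δ) • w ∈ φ '' D := by
    intro s hs hst
    rcases hs.1.eq_or_lt with rfl | hs0
    · simpa using ⟨γ 0, hmem 0 hs hst, rfl⟩
    have := (isFeasible_of_segment hφ hsheet hγ hγφ h1 ⟨hs0, hs.2⟩).eventually hφ hD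
      (hmem s hs hst)
    refine Tendsto.eventually (f := fun δ : ℝ => s * δ) ?_ this
    refine tendsto_nhdsWithin_iff.2 ⟨?_, ?_⟩
    · have : Tendsto (fun δ : ℝ => s * δ) (𝓝 0) (𝓝 (s * 0)) :=
        Continuous.tendsto (by fun_prop) 0
      rw [mul_zero] at this
      exact this.mono_left nhdsWithin_le_nhds
    · filter_upwards [self_mem_nhdsWithin] with δ hδ using mul_pos hs0 hδ
  -- For fixed δ the displaced point is affine in time, so by convexity it is enough to treat the
  -- two ends of the time interval.
  have ha : max 0 (t - ε / 2) ∈ Icc (0 : ℝ) 1 :=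
    ⟨le_max_left _ _, max_le zero_le_one (by linarith [ht.2])⟩
  have hb : min 1 (t + ε / 2) ∈ Icc (0 : ℝ) 1 :=
    ⟨le_min zero_le_one (by linarith [ht.1]), min_le_left _ _⟩
  have haε : |max 0 (t - ε / 2) - t| < ε := by
    rw [abs_lt]
    constructor
    · linarith [le_max_right 0 (t - ε / 2)]
    · have : max 0 (t - ε / 2) ≤ t := max_le ht.1 (by linarith)
      linarith
  have hbε : |min 1 (t + ε / 2) - t| < ε := by
    rw [abs_lt]
    constructor
    · have : t ≤ min 1 (t + ε / 2) := le_min ht.2 (by linarith)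
      linarith
    · linarith [min_le_right 1 (t + ε / 2)]
  filter_upwards [hfe _ ha haε, hfe _ hb hbε] with δ hδa hδb
  rintro τ ⟨hτ, hτε⟩
  rw [Metric.mem_ball, Real.dist_eq] at hτε
  refine ⟨hmem τ hτ (hτε.trans (half_lt_self hε)), ?_⟩
  rw [abs_lt] at hτε
  have hτab : τ ∈ segment ℝ (max 0 (t - ε / 2)) (min 1 (t + ε / 2)) := by
    rw [segment_eq_uIcc]
    exact Icc_subset_uIcc ⟨max_le hτ.1 (by linarith), le_min hτ.2 (by linarith)⟩
  rw [segment_eq_image_lineMap] at hτab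
  obtain ⟨c, hc, hcτ⟩ := hτab
  convert hD.convex.lineMap_mem hδa hδb hc using 1
  rw [hγφ _ ha, hγφ _ hb, hγφ _ hτ, ← hcτ]
  simp only [AffineMap.lineMap_apply_module, smul_eq_mul]
  module

/-- Displacing the lift at time t by tδ(φ z - φ y) gives the segment with the moved end point.
Feasibility along the lift lets each displaced point lift, and compactness of `Icc 0 1` yields one δ
for all t. -/
theorem Visible.exists_sweep (hφ : IsProperMap φ)
    (hsheet : ∀ p : M, ∃ B D, IsConvexSheet φ B D ∧ p ∈ D) (hD : IsConvexSheet φ B D) {x y z : M}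
    (hxy : Visible φ x y) (hy : y ∈ D) (hz : z ∈ D) :
    ∃ z' ∈ D, ∃ δ ∈ Ioc (0 : ℝ) 1, φ z' = AffineMap.lineMap (φ y) (φ z) δ ∧ Visible φ x z' := by
  have : Nonempty M := ⟨x⟩
  obtain ⟨γ, hγ, h0, h1, hγφ⟩ := hxy
  set w := φ z - φ y with hw
  have hfeas : IsFeasible φ w (γ 1) :=
    ⟨B, D, hD, h1 ▸ hy, 1, one_pos, by rw [h1]; simpa [hw] using mem_image_of_mem φ hz⟩
  have hunif : ∀ᶠ δ in 𝓝[>] (0 : ℝ), ∀ t ∈ Icc (0 : ℝ) 1, ∃ B D, IsConvexSheet φ B D ∧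
      ∀ᶠ τ in 𝓝[Icc 0 1] t, γ τ ∈ D ∧ φ (γ τ) + (τ * δ) • w ∈ φ '' D := by
    refine isCompact_Icc.induction_on (p := fun s => ∀ᶠ δ in 𝓝[>] (0 : ℝ), ∀ t ∈ s, ∃ B D,
      IsConvexSheet φ B D ∧ ∀ᶠ τ in 𝓝[Icc 0 1] t, γ τ ∈ D ∧ φ (γ τ) + (τ * δ) • w ∈ φ '' D)
      (by simp) ?_ ?_ ?_
    · exact fun s s' hs h => h.mono fun δ hδ t ht => hδ t (hs ht)
    · intro s s' h h'
      filter_upwards [h, h'] with δ hδ hδ' t ht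
      exact ht.elim (hδ t) (hδ' t)
    · intro t ht
      obtain ⟨B, D, hD, U, hU, htU, h⟩ :=
        exists_sheet_eventually_mem_image hφ hsheet hγ hγφ hfeas ht
      refine ⟨Icc 0 1 ∩ U, inter_mem self_mem_nhdsWithin
        (mem_nhdsWithin_of_mem_nhds (hU.mem_nhds htU)), ?_⟩
      filter_upwards [h] with δ hδ t' ht'
      refine ⟨B, D, hD, ?_⟩
      filter_upwards [self_mem_nhdsWithin,
        mem_nhdsWithin_of_mem_nhds (hU.mem_nhds ht'.2)] with τ hτ hτU using hδ τ ⟨hτ, hτU⟩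
  obtain ⟨δ, hδ, hδ01⟩ := (hunif.and (Ioc_mem_nhdsGT one_pos)).exists
  have hpt : ∀ t ∈ Icc (0 : ℝ) 1, ∃ m, φ m = φ (γ t) + (t * δ) • w ∧
      ∃ B D, IsConvexSheet φ B D ∧ γ t ∈ D ∧ m ∈ D := by
    intro t ht
    obtain ⟨B, D, hD, h⟩ := hδ t ht
    obtain ⟨h, m, hm, hmφ⟩ := h.self_of_nhdsWithin ht
    exact ⟨m, hmφ, B, D, hD, h, hm⟩
  choose! g hg hgD using hpt
  have hg0 : g 0 = x := by
    obtain ⟨B, D, hD, h, h'⟩ := hgD 0 (by simp)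
    refine hD.injOn h' (h0 ▸ h) ?_
    rw [hg 0 (by simp), h0]
    simp
  have hg1 : φ (g 1) = AffineMap.lineMap (φ y) (φ z) δ := by
    rw [hg 1 (by simp), h1, hw, AffineMap.lineMap_apply_module]
    module
  have hgφ : ∀ t ∈ Icc (0 : ℝ) 1, φ (g t) = AffineMap.lineMap (φ x) (φ (g 1)) t := by
    intro t ht
    rw [hg t ht, hg1, hγφ t ht, hw]
    simp only [AffineMap.lineMap_apply_module]
    module
  refine ⟨g 1, ?_, δ, hδ01, hg1, g, ?_, hg0, rfl, hgφ⟩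
  · obtain ⟨B', D', hD', h, h'⟩ := hgD 1 (by simp)
    refine hD.mem_of_mem_sheet hφ hD' hy (h1 ▸ h) h' ?_
    rw [hg1]
    exact hD.convex.lineMap_mem (mem_image_of_mem φ hy) (mem_image_of_mem φ hz)
      ⟨hδ01.1.le, hδ01.2⟩
  · refine continuousOn_of_locally_mem_sheet hφ ?_ fun t ht => ?_
    · exact ContinuousOn.congr (f := fun t => AffineMap.lineMap (φ x) (φ (g 1)) t) (by fun_prop) hgφ
    obtain ⟨B, D, hD, h⟩ := hδ t ht
    refine ⟨B, D, hD, ?_⟩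
    filter_upwards [h, self_mem_nhdsWithin] with τ hτ hτ01
    -- `g τ` was chosen in a sheet depending on τ; it must be relocated in the sheet attached to
    -- `t`.
    obtain ⟨B', D', hD', h1, h2⟩ := hgD τ hτ01
    refine hD.mem_of_mem_sheet hφ hD' hτ.1 h1 h2 ?_
    rw [hg τ hτ01]
    exact hτ.2

/-- Continuous induction along the lift γ from `y` to `z`: the times s at which `x` sees γ s form a
closed set, and sweeping inside a sheet pushes past any such s < 1. -/
theorem Visible.trans (hφ : IsProperMap φ)
    (hsheet : ∀ p : M, ∃ B D, IsConvexSheet φ B D ∧ p ∈ D) {x y z : M}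
    (hxy : Visible φ x y) (hyz : Visible φ y z) : Visible φ x z := by
  obtain ⟨γ, hγ, h0, h1, hγφ⟩ := hyz
  have hclosed : IsClosed ({s | Visible φ x (γ s)} ∩ Icc 0 1) := by
    rw [inter_comm]
    exact hγ.preimage_isClosed_of_isClosed isClosed_Icc (isClosed_setOf_visible hφ hsheet x)
  have hsub := hclosed.Icc_subset_of_forall_exists_gt (by simpa [h0] using hxy) ?_
  · have := hsub (right_mem_Icc.2 zero_le_one)
    rwa [mem_ofPred_eq, h1] at this
  rintro s ⟨hs, hs0, hs1⟩ b hb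
  obtain ⟨B, D, hD, ε, hε, hmem⟩ := exists_ball_mapsTo_sheet hsheet hγ ⟨hs0, hs1.le⟩
  obtain ⟨r, hr⟩ : (Ioo s (min (min 1 b) (s + ε))).Nonempty := by
    rw [nonempty_Ioo]
    exact lt_min (lt_min hs1 hb) (by linarith)
  have hr' := lt_min_iff.1 hr.2
  have hr'' := lt_min_iff.1 hr'.1
  have hIcc : ∀ τ ∈ Icc s r, τ ∈ Icc (0 : ℝ) 1 ∧ γ τ ∈ D := by
    intro τ hτ
    have h01 : τ ∈ Icc (0 : ℝ) 1 := ⟨hs0.trans hτ.1, hτ.2.trans hr''.1.le⟩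
    refine ⟨h01, hmem τ h01 ?_⟩
    rw [abs_lt]
    constructor <;> linarith [hτ.1, hτ.2]
  have hsI := hIcc s ⟨le_rfl, hr.1.le⟩
  have hrI := hIcc r ⟨hr.1.le, le_rfl⟩
  obtain ⟨z', hz', δ, hδ, hzφ, hvis⟩ := Visible.exists_sweep hφ hsheet hD hs hsI.2 hrI.2
  have hδI : AffineMap.lineMap s r δ ∈ Icc s r := by
    have := (convex_Icc s r).lineMap_mem ⟨le_rfl, hr.1.le⟩ ⟨hr.1.le, le_rfl⟩ ⟨hδ.1.le, hδ.2⟩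
    exact this
  have hzeq : z' = γ (AffineMap.lineMap s r δ) := by
    refine hD.injOn hz' (hIcc _ hδI).2 ?_
    rw [hzφ, hγφ _ hsI.1, hγφ _ hrI.1, hγφ _ (hIcc _ hδI).1]
    simp only [AffineMap.lineMap_apply_module, smul_eq_mul]
    module
  refine ⟨AffineMap.lineMap s r δ, ?_, ?_, hδI.2.trans hr''.2.le⟩
  · rw [mem_ofPred_eq, ← hzeq]
    exact hvis
  · rw [AffineMap.lineMap_apply_module, smul_eq_mul, smul_eq_mul]
    nlinarith [hδ.1, hr.1]

/-- **Local-to-global principle.** A proper map with convex sheets through every point of a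
preconnected space is injective and has convex image. -/
theorem injective_and_convex_range_of_sheets [PreconnectedSpace M] (hφ : IsProperMap φ)
    (hsheet : ∀ p : M, ∃ B D, IsConvexSheet φ B D ∧ p ∈ D) :
    Function.Injective φ ∧ Convex ℝ (range φ) := by
  have hvis : ∀ x y, Visible φ x y := by
    intro x
    have hclopen : IsClopen {y | Visible φ x y} := by
      refine ⟨isClosed_setOf_visible hφ hsheet x, isOpen_iff_mem_nhds.2 fun y hy => ?_⟩
      obtain ⟨B, D, hD, hp⟩ := hsheet y
      filter_upwards [hD.isOpen.mem_nhds hp] with z hz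
      exact Visible.trans hφ hsheet hy (hD.visible hφ hp hz)
    have hne : {y | Visible φ x y}.Nonempty := by
      obtain ⟨B, D, hD, hp⟩ := hsheet x
      exact ⟨x, hD.visible hφ hp hp⟩
    exact eq_univ_iff_forall.1 (hclopen.eq_univ hne)
  constructor
  · intro x y hxy
    obtain ⟨γ, hγ, h0, h1, hγφ⟩ := hvis x y
    obtain ⟨B, D, hD, hp⟩ := hsheet x
    have hsub : γ '' Icc 0 1 ⊆ D := by
      refine hD.subset_of_isPreconnected (isPreconnected_Icc.image γ hγ) ?_
        ⟨x, ⟨0, by simp, h0⟩, hp⟩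
      rintro _ ⟨t, ht, rfl⟩
      rw [hγφ t ht, ← hxy, AffineMap.lineMap_same_apply]
      exact hD.mapsTo hp
    exact hD.injOn hp (hsub ⟨1, by simp, h1⟩) hxy
  · rw [convex_iff_segment_subset]
    rintro _ ⟨x, rfl⟩ _ ⟨y, rfl⟩
    rw [segment_eq_image_lineMap]
    rintro _ ⟨t, ht, rfl⟩
    obtain ⟨γ, -, -, -, hγφ⟩ := hvis x y
    exact ⟨γ t, hγφ t ht⟩

end SegmentLifting

/-! ### The space of fiber components: sheets and properness. -/

section FiberComponents

variable {X V : Type*} [TopologicalSpace X]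

/-- The connected component of `x` in its fiber. -/
def fiberComponent (f : X → V) (x : X) : Set X :=
  connectedComponentIn (f ⁻¹' {f x}) x

/-- The union of the fiber components that meet `A`. -/
def fiberSaturation (f : X → V) (A : Set X) : Set X :=
  {x | ∃ a ∈ A, fiberComponent f x = fiberComponent f a}

/-- The space of connected components of the fibers of `f`, with the quotient topology. -/
abbrev FiberComponents (f : X → V) : Type _ :=
  Quotient (Setoid.ker (fiberComponent f))

variable {f : X → V}

theorem mem_fiberComponent (x : X) : x ∈ fiberComponent f x :=
  mem_connectedComponentIn rfl

theorem fiberComponent_subset (x : X) : fiberComponent f x ⊆ f ⁻¹' {f x} :=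
  connectedComponentIn_subset _ _

theorem isPreconnected_fiberComponent (x : X) : IsPreconnected (fiberComponent f x) :=
  isPreconnected_connectedComponentIn

theorem fiberComponent_eq_of_mem {x y : X} (h : y ∈ fiberComponent f x) :
    fiberComponent f x = fiberComponent f y := by
  have hy : f y = f x := fiberComponent_subset x h
  rw [fiberComponent, fiberComponent, hy]
  exact connectedComponentIn_eq h

theorem fiberComponent_eq_iff {x y : X} :
    fiberComponent f x = fiberComponent f y ↔ y ∈ fiberComponent f x :=
  ⟨fun h => h ▸ mem_fiberComponent y, fiberComponent_eq_of_mem⟩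

theorem map_eq_of_fiberComponent_eq {x y : X} (h : fiberComponent f x = fiberComponent f y) :
    f x = f y :=
  (fiberComponent_subset x (fiberComponent_eq_iff.1 h)).symm

theorem subset_fiberSaturation (A : Set X) : A ⊆ fiberSaturation f A :=
  fun a ha => ⟨a, ha, rfl⟩

theorem image_fiberSaturation (A : Set X) : f '' fiberSaturation f A = f '' A := by
  refine Subset.antisymm ?_ (image_mono (subset_fiberSaturation A))
  rintro _ ⟨x, ⟨a, ha, hxa⟩, rfl⟩
  exact ⟨a, ha, (map_eq_of_fiberComponent_eq hxa).symm⟩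

theorem isClosed_fiberComponent [TopologicalSpace V] [T1Space V] (hf : Continuous f) (x : X) : IsClosed (fiberComponent f x) :=
  isClosed_of_closure_subset <|
    (isPreconnected_fiberComponent x).closure.subset_connectedComponentIn
      (subset_closure (mem_fiberComponent x))
      (closure_minimal (fiberComponent_subset x) (isClosed_singleton.preimage hf))

variable [NormedAddCommGroup V] [NormedSpace ℝ V]

/-- Openness of the restriction into the cone supplies the neighborhood property at every point of
the chart, not only at the vertex. -/
theorem HasLocalConvexityData.exists_chart (hlcd : HasLocalConvexityData f)
    (hlfc : IsLocallyFiberConnected f) (x : X) {O : Set X} (hO : IsOpen O) (hx : x ∈ O) :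
    ∃ U : Set X, IsOpen U ∧ x ∈ U ∧ U ⊆ O ∧
      (∀ y ∈ U, ∀ z ∈ U, f y = f z → fiberComponent f y = fiberComponent f z) ∧
      ∃ C : Set V, Convex ℝ C ∧ MapsTo f U C ∧
        ∀ y ∈ U, ∀ U' ∈ 𝓝 y, f '' U' ∈ 𝓝[C] (f y) := by
  obtain ⟨N, hN, hNC⟩ := hlcd x
  obtain ⟨A, hA, hAO, hAc⟩ := hlfc x (O ∩ interior N) (hO.inter isOpen_interior)
    ⟨hx, mem_interior_iff_mem_nhds.2 hN⟩
  have hxU : x ∈ interior A := mem_interior_iff_mem_nhds.2 hA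
  obtain ⟨C, hUC, hC, -, -, hopen, -⟩ := hNC (interior A) isOpen_interior hxU
    (interior_subset.trans (hAO.trans (inter_subset_right.trans interior_subset)))
  refine ⟨interior A, isOpen_interior, hxU, interior_subset.trans (hAO.trans inter_subset_left),
    ?_, C, hC, hUC, ?_⟩
  · intro y hy z hz hyz
    have := hAc y (interior_subset hy) y ⟨interior_subset hy, rfl⟩ z
      ⟨interior_subset hz, hyz.symm⟩
    rw [fiberComponent, this, fiberComponent, hyz]
  · intro y hy U' hU'
    have h1 : (Subtype.val ⁻¹' U' : Set (interior A)) ∈ 𝓝 (⟨y, hy⟩ : interior A) :=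
      continuous_subtype_val.continuousAt.preimage_mem_nhds hU'
    have h2 := (hopen.image_mem_nhds h1)
    rw [mem_nhds_subtype_iff_nhdsWithin] at h2
    refine mem_of_superset h2 ?_
    rintro _ ⟨_, ⟨u, hu, rfl⟩, rfl⟩
    exact ⟨u, hu, rfl⟩

/-- Inside a chart, lying in the interior of the saturation depends only on the value of `f`
(`key`). It is thus locally constant along a fiber component and spreads from a point of `U` to the
whole component. -/
theorem isOpen_fiberSaturation (hf : Continuous f) (hlcd : HasLocalConvexityData f)
    (hlfc : IsLocallyFiberConnected f) {U : Set X} (hU : IsOpen U) :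
    IsOpen (fiberSaturation f U) := by
  have key : ∀ W : Set X, IsOpen W →
      (∀ y ∈ W, ∀ z ∈ W, f y = f z → fiberComponent f y = fiberComponent f z) →
      ∀ C : Set V, MapsTo f W C → (∀ y ∈ W, ∀ U' ∈ 𝓝 y, f '' U' ∈ 𝓝[C] (f y)) →
      ∀ y ∈ W, ∀ z ∈ W, f y = f z → z ∈ interior (fiberSaturation f U) →
      y ∈ interior (fiberSaturation f U) := by
    intro W hW hWc C hWC hWn y hy z hz hyz hzU
    have h1 := hWn z hz _ (inter_mem (isOpen_interior.mem_nhds hzU) (hW.mem_nhds hz))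
    rw [← hyz] at h1
    have h2 : Tendsto f (𝓝 y) (𝓝[C] (f y)) :=
      tendsto_nhdsWithin_iff.2 ⟨hf.tendsto y, mem_of_superset (hW.mem_nhds hy) hWC⟩
    rw [mem_interior_iff_mem_nhds]
    filter_upwards [h2 h1, hW.mem_nhds hy] with p hp hpW
    obtain ⟨q, ⟨hq, hqW⟩, hqp⟩ := hp
    obtain ⟨u, hu, hqu⟩ := interior_subset hq
    exact ⟨u, hu, (hWc p hpW q hqW hqp.symm).trans hqu⟩
  rw [← subset_interior_iff_isOpen]
  rintro x ⟨u, hu, hxu⟩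
  have hiff : u ∈ interior (fiberSaturation f U) ↔ x ∈ interior (fiberSaturation f U) := by
    refine (isPreconnected_fiberComponent (f := f) u).induction₂
      (fun y z => y ∈ interior (fiberSaturation f U) ↔ z ∈ interior (fiberSaturation f U))
      ?_ ?_ ?_ (mem_fiberComponent u) (fiberComponent_eq_iff.1 hxu.symm)
    · intro y hy
      obtain ⟨W, hW, hyW, -, hWc, C, -, hWC, hWn⟩ := hlcd.exists_chart hlfc y isOpen_univ trivial
      filter_upwards [self_mem_nhdsWithin, mem_nhdsWithin_of_mem_nhds (hW.mem_nhds hyW)]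
        with z hz hzW
      have hyz : f y = f z :=
        (fiberComponent_subset u hy).trans (fiberComponent_subset u hz).symm
      exact ⟨key W hW hWc C hWC hWn z hzW y hyW hyz.symm, key W hW hWc C hWC hWn y hyW z hzW hyz⟩
    · intro x y z _ _ _ h h'
      exact h.trans h'
    · intro x y _ _ h
      exact h.symm
  refine hiff.1 (interior_mono (subset_fiberSaturation U) ?_)
  rwa [hU.interior_eq]

/-- Small open sets have an open saturation that meets each fiber in at most one component and is
mapped into a convex set. -/
theorem exists_saturated_chart (hf : Continuous f) (hlcd : HasLocalConvexityData f)
    (hlfc : IsLocallyFiberConnected f) (x : X) {O : Set X} (hO : IsOpen O) (hx : x ∈ O) :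
    ∃ U : Set X, IsOpen U ∧ x ∈ U ∧ U ⊆ O ∧ IsOpen (fiberSaturation f U) ∧
      (∀ y ∈ fiberSaturation f U, ∀ z ∈ fiberSaturation f U, f y = f z →
        fiberComponent f y = fiberComponent f z) ∧
      ∃ C : Set V, Convex ℝ C ∧ MapsTo f (fiberSaturation f U) C ∧
        ∀ U' ∈ 𝓝 x, f '' U' ∈ 𝓝[C] (f x) := by
  obtain ⟨U, hU, hxU, hUO, hUc, C, hC, hUC, hUn⟩ := hlcd.exists_chart hlfc x hO hx
  refine ⟨U, hU, hxU, hUO, isOpen_fiberSaturation hf hlcd hlfc hU, ?_, C, hC, ?_, hUn x hxU⟩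
  · rintro y ⟨u, hu, hyu⟩ z ⟨v, hv, hzv⟩ hyz
    rw [hyu, hzv]
    refine hUc u hu v hv ?_
    rw [← map_eq_of_fiberComponent_eq hyu, hyz, map_eq_of_fiberComponent_eq hzv]
  · rw [mapsTo_iff_image_subset, image_fiberSaturation]
    exact hUC.image_subset

/-- The map induced by `f` on the space of fiber components. -/
def fiberComponentsMap (f : X → V) : FiberComponents f → V :=
  Quotient.lift f fun _ _ h => map_eq_of_fiberComponent_eq h

/-- Normality puts an open `O` between the component of `x` and the saturated chart, with closure
inside the chart. The fiber of `f x` avoids the boundary of `O`; by closedness so do nearby fibers,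
so over a small ball `O` is clopen and saturated. Its image is the convex set `C ∩ B`. -/
theorem exists_isConvexSheet [NormalSpace X] (hf : Continuous f) (hcl : IsClosedMap f)
    (hlcd : HasLocalConvexityData f) (hlfc : IsLocallyFiberConnected f) (p : FiberComponents f) :
    ∃ B D, IsConvexSheet (fiberComponentsMap f) B D ∧ p ∈ D := by
  obtain ⟨x, rfl⟩ := Quotient.exists_rep p
  obtain ⟨U, hU, hxU, -, hsat, hUc, C, hC, hUC, hUn⟩ :=
    exists_saturated_chart hf hlcd hlfc x isOpen_univ trivial
  have hxsat : fiberComponent f x ⊆ fiberSaturation f U := fun y hy =>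
    ⟨x, hxU, (fiberComponent_eq_of_mem hy).symm⟩
  obtain ⟨O, hO, hxO, hOU⟩ := normal_exists_closure_subset (isClosed_fiberComponent hf x) hsat hxsat
  have hcover : ∀ᶠ v in 𝓝 (f x), f ⁻¹' {v} ⊆ O ∪ (closure O)ᶜ := by
    refine hcl.eventually_nhds_fiber (p := fun y => y ∈ O ∪ (closure O)ᶜ) (f x) fun y hy => ?_
    refine (hO.union isClosed_closure.isOpen_compl).mem_nhds ?_
    by_cases hyU : y ∈ fiberSaturation f U
    · exact Or.inl (hxO (fiberComponent_eq_iff.1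
        (hUc x (subset_fiberSaturation U hxU) y hyU hy.symm)))
    · exact Or.inr fun h => hyU (hOU h)
  have himage : ∀ᶠ v in 𝓝 (f x), v ∈ C → v ∈ f '' O :=
    mem_nhdsWithin_iff_eventually.1
      (hUn O (hO.mem_nhds (hxO (mem_fiberComponent x))))
  obtain ⟨r, hr, hball⟩ := Metric.eventually_nhds_iff_ball.1 (hcover.and himage)
  set B := Metric.ball (f x) r with hB
  have hdisj : Disjoint O (closure O)ᶜ := disjoint_compl_right.mono_left subset_closure
  have hBcover : f ⁻¹' B ⊆ O ∪ (closure O)ᶜ := fun y hy => (hball _ hy).1 rfl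
  have hsplit : ∀ y ∈ O ∩ f ⁻¹' B, ∀ z, fiberComponent f y = fiberComponent f z →
      z ∈ O ∩ f ⁻¹' B := by
    rintro y ⟨hyO, hyB⟩ z hyz
    have hsub : fiberComponent f y ⊆ f ⁻¹' B := fun q hq => by
      have : f q = f y := fiberComponent_subset y hq
      rw [mem_preimage, this]
      exact hyB
    have hz := fiberComponent_eq_iff.1 hyz
    exact ⟨(isPreconnected_fiberComponent y).subset_left_of_subset_union hO
      isClosed_closure.isOpen_compl hdisj (hsub.trans hBcover) ⟨y, mem_fiberComponent y, hyO⟩ hz,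
      hsub hz⟩
  set π : X → FiberComponents f := Quotient.mk (Setoid.ker (fiberComponent f)) with hπ
  have hpre : π ⁻¹' (π '' (O ∩ f ⁻¹' B)) =
      O ∩ f ⁻¹' B := by
    refine Subset.antisymm ?_ (subset_preimage_image _ _)
    rintro z ⟨y, hy, hyz⟩
    exact hsplit y hy z (Quotient.exact hyz)
  have hquot : IsQuotientMap π := isQuotientMap_quot_mk
  refine ⟨B, π '' (O ∩ f ⁻¹' B), ⟨Metric.isOpen_ball, ?_, ?_, ?_, ?_, ?_⟩,
    ⟨x, ⟨hxO (mem_fiberComponent x), Metric.mem_ball_self hr⟩, rfl⟩⟩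
  · rintro _ ⟨y, hy, rfl⟩
    exact hy.2
  · rw [← hquot.isOpen_preimage, hpre]
    exact hO.inter (Metric.isOpen_ball.preimage hf)
  · rw [← hquot.isOpen_preimage, preimage_sdiff, hpre]
    have : π ⁻¹' (fiberComponentsMap f ⁻¹' B) \ (O ∩ f ⁻¹' B) = f ⁻¹' B ∩ (closure O)ᶜ := by
      ext y
      constructor
      · rintro ⟨hy, hy'⟩
        exact ⟨hy, (hBcover hy).resolve_left fun h => hy' ⟨h, hy⟩⟩
      · rintro ⟨hy, hy'⟩
        exact ⟨hy, fun h => hy' (subset_closure h.1)⟩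
    rw [this]
    exact (Metric.isOpen_ball.preimage hf).inter isClosed_closure.isOpen_compl
  · rintro _ ⟨y, hy, rfl⟩ _ ⟨z, hz, rfl⟩ hyz
    exact Quotient.sound (hUc y (hOU (subset_closure hy.1)) z (hOU (subset_closure hz.1)) hyz)
  · have : fiberComponentsMap f '' (π '' (O ∩ f ⁻¹' B)) = C ∩ B := by
      rw [image_image]
      ext v
      constructor
      · rintro ⟨y, hy, rfl⟩
        exact ⟨hUC (hOU (subset_closure hy.1)), hy.2⟩
      · rintro ⟨hvC, hvB⟩
        obtain ⟨y, hy, rfl⟩ := (hball v hvB).2 hvC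
        exact ⟨y, ⟨hy, hvB⟩, rfl⟩
    rw [this]
    exact hC.inter (convex_ball _ _)

/-- If a fiber had infinitely many components, numbering a sequence of them and extending by Tietze
would give a continuous `G` with `G (x n) = n`. Points `y n` near `x n`, off the fiber but with `f
(y n)` tending to `v`, form a closed set whose image misses its limit `v`. -/
theorem finite_fiberComponentsMap_fiber [NormalSpace X] [T1Space X] [PreconnectedSpace X]
    (hf : Continuous f)
    (hcl : IsClosedMap f) (hlcd : HasLocalConvexityData f) (hlfc : IsLocallyFiberConnected f)
    (v : V) : (fiberComponentsMap f ⁻¹' {v}).Finite := by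
  by_contra hinf
  obtain ⟨p, hp, hpv⟩ : ∃ p : ℕ → FiberComponents f, Function.Injective p ∧
      ∀ n, fiberComponentsMap f (p n) = v :=
    ⟨fun n => Set.Infinite.natEmbedding _ hinf n,
      Subtype.val_injective.comp (Set.Infinite.natEmbedding _ hinf).injective,
      fun n => (Set.Infinite.natEmbedding _ hinf n).2⟩
  choose x hx using fun n => Quotient.exists_rep (p n)
  have hxv : ∀ n, f (x n) = v := fun n => by
    rw [← hpv n, ← hx n]
    rfl
  have hxinj : ∀ m n, fiberComponent f (x m) = fiberComponent f (x n) → m = n := by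
    intro m n h
    refine hp ?_
    rw [← hx m, ← hx n]
    exact Quotient.sound h
  classical
  -- The label depends only on the fiber component, so it is locally constant on the fiber whatever
  -- the default value.
  let label : X → ℝ := fun y =>
    if h : ∃ n, fiberComponent f y = fiberComponent f (x n) then (h.choose : ℝ) else 0
  have hlabel : ∀ n, label (x n) = n := by
    intro n
    have h : ∃ m, fiberComponent f (x n) = fiberComponent f (x m) := ⟨n, rfl⟩
    simp only [label, dif_pos h]
    exact_mod_cast (hxinj _ _ h.choose_spec).symm
  have hlabel_cont : ContinuousOn label (f ⁻¹' {v}) := by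
    intro y hy
    obtain ⟨U, hU, hyU, -, -, hUc, -⟩ :=
      exists_saturated_chart hf hlcd hlfc y isOpen_univ trivial
    refine tendsto_const_nhds.congr' ?_
    filter_upwards [self_mem_nhdsWithin, mem_nhdsWithin_of_mem_nhds (hU.mem_nhds hyU)] with z hz hzU
    have : fiberComponent f y = fiberComponent f z := hUc y (subset_fiberSaturation U hyU) z
      (subset_fiberSaturation U hzU) (hy.trans hz.symm)
    simp only [label, this]
  obtain ⟨G, hG⟩ := ContinuousMap.exists_restrict_eq (isClosed_singleton.preimage hf)
    (⟨_, hlabel_cont.domRestrict⟩ : C(f ⁻¹' {v}, ℝ))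
  have hGx : ∀ n, G (x n) = n := by
    intro n
    rw [← hlabel n]
    exact DFunLike.congr_fun hG ⟨x n, hxv n⟩
  -- Were `f` constant near `x n`, its component would be clopen, hence all of `X`, leaving no room
  -- for the component of `x (n + 1)`.
  have hnonconst : ∀ n, ∃ᶠ y in 𝓝 (x n), f y ≠ v := by
    intro n h
    obtain ⟨O, hOv, hO, hxO⟩ := mem_nhds_iff.1 h
    obtain ⟨U, hU, hxU, hUO, hsat, hUc, -⟩ :=
      exists_saturated_chart hf hlcd hlfc (x n) hO hxO
    have heq : fiberComponent f (x n) = fiberSaturation f U := by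
      refine Subset.antisymm
        (fun y hy => ⟨x n, hxU, (fiberComponent_eq_of_mem hy).symm⟩) fun y hy => ?_
      refine fiberComponent_eq_iff.1 (hUc _ (subset_fiberSaturation U hxU) y hy ?_)
      obtain ⟨u, hu, hyu⟩ := hy
      rw [map_eq_of_fiberComponent_eq hyu, hxv n]
      exact (not_not.1 (hOv (hUO hu))).symm
    have huniv := IsClopen.eq_univ ⟨isClosed_fiberComponent hf (x n), heq ▸ hsat⟩
      ⟨x n, mem_fiberComponent (x n)⟩
    have h1 := hxinj n (n + 1) (fiberComponent_eq_iff.2 (huniv ▸ mem_univ _))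
    omega
  have hy : ∀ n : ℕ, ∃ y, f y ≠ v ∧ dist (f y) v < 1 / (n + 1) ∧ dist (G y) n < 1 := by
    intro n
    have h1 : ∀ᶠ y in 𝓝 (x n), dist (f y) v < 1 / (n + 1) := by
      rw [← hxv n]
      exact hf.continuousAt (Metric.ball_mem_nhds _ (by positivity))
    have h2 : ∀ᶠ y in 𝓝 (x n), dist (G y) n < 1 := by
      rw [← hGx n]
      exact G.continuous.continuousAt (Metric.ball_mem_nhds _ one_pos)
    exact ((hnonconst n).and_eventually (h1.and h2)).exists
  choose y hyv hyd hyG using hy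
  have hclosed : IsClosed (range y) := by
    rw [← iUnion_singleton_eq_range]
    refine LocallyFinite.isClosed_iUnion (fun z => ?_) fun n => isClosed_singleton
    refine ⟨G ⁻¹' Metric.ball (G z) 1,
      G.continuous.continuousAt (Metric.ball_mem_nhds _ one_pos), ?_⟩
    refine (finite_Iic ⌈G z + 2⌉₊).subset ?_
    rintro n ⟨_, rfl, hn⟩
    have h1 := hyG n
    rw [mem_preimage, Metric.mem_ball] at hn
    rw [Real.dist_eq, abs_lt] at hn h1
    have : (n : ℝ) ≤ ⌈G z + 2⌉₊ := le_trans (by linarith) (Nat.le_ceil _)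
    exact_mod_cast this
  have hlim : Tendsto (fun n => f (y n)) atTop (𝓝 v) := by
    rw [tendsto_iff_dist_tendsto_zero]
    exact squeeze_zero (fun _ => dist_nonneg) (fun n => (hyd n).le)
      tendsto_one_div_add_atTop_nhds_zero_nat
  obtain ⟨_, ⟨n, rfl⟩, hn⟩ := (hcl _ hclosed).mem_of_tendsto hlim
    (Eventually.of_forall fun n => mem_image_of_mem f (mem_range_self n))
  exact hyv n hn

theorem isProperMap_fiberComponentsMap [NormalSpace X] [T1Space X] [PreconnectedSpace X]
    (hf : Continuous f)
    (hcl : IsClosedMap f) (hlcd : HasLocalConvexityData f) (hlfc : IsLocallyFiberConnected f) :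
    IsProperMap (fiberComponentsMap f) := by
  rw [isProperMap_iff_isClosedMap_and_compact_fibers]
  refine ⟨hf.quotient_lift _, fun A hA => ?_, fun v =>
    (finite_fiberComponentsMap_fiber hf hcl hlcd hlfc v).isCompact⟩
  have h := hcl _ (hA.preimage continuous_quot_mk)
  convert h using 1
  ext v
  constructor
  · rintro ⟨p, hp, rfl⟩
    obtain ⟨x, rfl⟩ := Quotient.exists_rep p
    exact ⟨x, hp, rfl⟩
  · rintro ⟨x, hx, rfl⟩
    exact ⟨_, hx, rfl⟩

end FiberComponents

/-! ### Return to the weak* topology. -/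

theorem mainTheorem9 {X W : Type*} [TopologicalSpace X] [ConnectedSpace X]
    [LocallyConnectedSpace X] [FirstCountableTopology X] [T4Space X]
    [NormedAddCommGroup W] [NormedSpace ℝ W] [CompleteSpace W]
    (f : X → StrongDual ℝ W)
    (hf_cont : Continuous f)
    (hf_closed : IsClosedMap (fun x : X => StrongDual.toWeakDual (f x)))
    (hf_lcd : HasLocalConvexityData f)
    (hf_lfc : IsLocallyFiberConnected f) :
    (∀ v ∈ range f, IsConnected (f ⁻¹' {v})) ∧
    IsOpenMap (rangeFactorization (fun x : X => StrongDual.toWeakDual (f x))) ∧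
    IsClosed (range (fun x : X => StrongDual.toWeakDual (f x))) ∧
    Convex ℝ (range (fun x : X => StrongDual.toWeakDual (f x))) := by
  -- The norm topology is finer than the weak* topology, so weak* closed images are norm closed.
  have hcl : IsClosedMap f := by
    intro A hA
    have h := (hf_closed A hA).preimage NormedSpace.Dual.toWeakDual_continuous
    convert h using 1
    ext v
    simp [eq_comm]
  obtain ⟨hinj, hconv⟩ := injective_and_convex_range_of_sheets
    (isProperMap_fiberComponentsMap hf_cont hcl hf_lcd hf_lfc)
    (exists_isConvexSheet hf_cont hcl hf_lcd hf_lfc)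
  have hfiber : ∀ x y, f x = f y → fiberComponent f x = fiberComponent f y := fun x y h =>
    Quotient.exact (hinj (a₁ := Quotient.mk _ x) (a₂ := Quotient.mk _ y) h)
  have hrange : range (fiberComponentsMap f) = range f := by
    refine Subset.antisymm ?_ ?_
    · rintro _ ⟨p, rfl⟩
      obtain ⟨x, rfl⟩ := Quotient.exists_rep p
      exact ⟨x, rfl⟩
    · rintro _ ⟨x, rfl⟩
      exact ⟨Quotient.mk _ x, rfl⟩
  refine ⟨?_, ?_, hf_closed.isClosed_range, ?_⟩
  · rintro _ ⟨x, rfl⟩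
    have : f ⁻¹' {f x} = fiberComponent f x := Subset.antisymm
      (fun y hy => fiberComponent_eq_iff.1 (hfiber x y hy.symm)) (fiberComponent_subset x)
    rw [this]
    exact ⟨⟨x, mem_fiberComponent x⟩, isPreconnected_fiberComponent x⟩
  · intro U hU
    -- As components are whole fibers, the image of the complement of the saturation is exactly the
    -- complement of the image of `U` in the range.
    have h := hf_closed _ (isOpen_fiberSaturation hf_cont hf_lcd hf_lfc hU).isClosed_compl
    refine isOpen_induced_iff.2 ⟨_, h.isOpen_compl, ?_⟩
    ext ⟨_, x, rfl⟩
    constructor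
    · intro hx
      obtain ⟨u, hu, hxu⟩ : x ∈ fiberSaturation f U := by
        by_contra hxU
        exact hx ⟨x, hxU, rfl⟩
      refine ⟨u, hu, Subtype.ext ?_⟩
      exact congrArg StrongDual.toWeakDual (map_eq_of_fiberComponent_eq hxu).symm
    · rintro ⟨u, hu, hux⟩ ⟨y, hy, hyx⟩
      have h1 := congrArg Subtype.val hux
      refine hy ⟨u, hu, hfiber y u ?_⟩
      exact StrongDual.toWeakDual.injective (hyx.trans h1.symm)
  · have h := hconv.linear_image (StrongDual.toWeakDual (𝕜 := ℝ) (E := W)).toLinearMap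
    rw [hrange, ← range_comp] at h
    exact h
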